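/- For an integer $k\ge 1$ and a real $\lambda>0$, the Poisson distribution of order $k$ with parameter $\lambda$ is the distribution on the non-negative integers with probability mass function $$f_k(x;\lambda)=\sum e^{-k\lambda}\,\frac{\lambda^{x_1+x_2+\cdots+x_k}}{x_1!\,x_2!\cdots x_k!},\qquad x=0,1,2,\ldots,$$ where the sum is over all $k$-tuples $(x_1,\ldots,x_k)$ of non-negative integers with $x_1+2x_2+\cdots+kx_k=x$. A mode is a value of $x$ at which $f_k(x;\lambda)$ attains its maximum over all non-negative integers. **Theorem 2.2.** For every positive integer $\lambda$ and every integer $k$ with $2\le k\le 5$, the Poisson distribution of order $k$ with parameter $\lambda$ has a unique mode $m_{k,\lambda}$, and $$m_{k,\lambda}=\frac{\lambda k(k+1)}{2}-\left\lfloor \frac{k}{2}\right\rfloor .$$ -/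

import Mathlib

open scoped Nat

/-- The `k`-tuples `(x₁, …, x_k)` of non-negative integers with `x₁ + 2 x₂ + ⋯ + k x_k = n`.
The entry `x_{i+1}` is `x i` for `i : Fin k`. The bound `x i ≤ n`, which only serves to make the set
visibly finite, is automatic: see `mem_orderTuples`. -/
def orderTuples (k n : ℕ) : Finset (Fin k → ℕ) :=
  (Fintype.piFinset fun _ : Fin k => Finset.range (n + 1)).filter
    fun x => ∑ i : Fin k, ((i : ℕ) + 1) * x i = n

theorem mem_orderTuples {k n : ℕ} {x : Fin k → ℕ} :
    x ∈ orderTuples k n ↔ ∑ i : Fin k, ((i : ℕ) + 1) * x i = n := by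
  simp only [orderTuples, Finset.mem_filter, Fintype.mem_piFinset, Finset.mem_range,
    and_iff_right_iff_imp]
  intro h i
  have h1 : ((i : ℕ) + 1) * x i ≤ ∑ j : Fin k, ((j : ℕ) + 1) * x j :=
    Finset.single_le_sum (f := fun j : Fin k => ((j : ℕ) + 1) * x j)
      (fun _ _ => Nat.zero_le _) (Finset.mem_univ i)
  have h2 : x i ≤ ((i : ℕ) + 1) * x i := Nat.le_mul_of_pos_left _ (Nat.succ_pos _)
  omega

/-- The probability mass function `f_k(n; l)` of the Poisson distribution of order `k` with
parameter `l`: the sum, over all `k`-tuples of non-negative integers with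
`x₁ + 2 x₂ + ⋯ + k x_k = n`, of `e^{-k l} l^{x₁ + ⋯ + x_k} / (x₁! ⋯ x_k!)`. -/
noncomputable def poissonOrderPMF (k : ℕ) (l : ℝ) (n : ℕ) : ℝ :=
  ∑ x ∈ orderTuples k n,
    Real.exp (-(k * l)) * (l ^ (∑ i : Fin k, x i) / ((∏ i : Fin k, (x i)! : ℕ) : ℝ))

/-- `m` is a mode of the mass function `f` on the non-negative integers: `f` attains its maximum
at `m`. -/
def IsMode (f : ℕ → ℝ) (m : ℕ) : Prop :=
  ∀ n : ℕ, f n ≤ f m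

/-!
Without the factor `e^{-k l}`, the mass function `f` satisfies `n f(n) = l ∑ i f(n - i)`, the sum
being over `1 ≤ i ≤ k`. Beyond the mean `μ = l k (k + 1) / 2` the coefficients on the right add up
to `μ < n`, so `f` stays below its previous maximum there.

Up to the mean one studies the increments `Δ`. Two successive instances of the recurrence give
`n t Δ(n) = l ∑ wᵢ(t) Δ(n - 1 - i)`, the sum being over `0 ≤ i < k`, where `t = μ + 1 - n` and the
weights `wᵢ(t)` are affine in `t` and independent of `l`. For `t ≥ k (k + 1) / 2` they are
nonnegative, hence `Δ(n) > 0`. For each of the finitely many smaller `t` one uses the recurrence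
to rewrite `Δ(n)`, up to a positive factor, as a linear form in increments already known to be
positive. The coefficients of this form are polynomials in `l`, which expanded in powers of `l - 3`
have only nonnegative coefficients if `t > ⌊k / 2⌋`, and only nonpositive ones if `t ≤ ⌊k / 2⌋`.
Thus for `l ≥ 3` the increments up to the mean change sign exactly once, at `μ - ⌊k / 2⌋`, while for
`l ≤ 2` the finitely many values of `f` up to the mean are compared directly.
-/

/-- The term `l^{x₁ + ⋯ + x_k} / (x₁! ⋯ x_k!)` which the tuple `x` contributes to the mass function,
without the factor `e^{-k l}`. -/
noncomputable def tupleWeight {k : ℕ} (l : ℝ) (x : Fin k → ℕ) : ℝ :=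
  l ^ (∑ i, x i) / ((∏ i, (x i)! : ℕ) : ℝ)

theorem succ_mul_tupleWeight_add_single {k : ℕ} (l : ℝ) (x : Fin k → ℕ) (i : Fin k) :
    ((x + Pi.single i 1 : Fin k → ℕ) i : ℝ) * tupleWeight l (x + Pi.single i 1 : Fin k → ℕ) =
      l * tupleWeight l x := by
  have hsum : ∑ j, (x + Pi.single i 1 : Fin k → ℕ) j = ∑ j, x j + 1 := by
    simp [Finset.sum_add_distrib]
  have hprod : ∏ j, ((x + Pi.single i 1 : Fin k → ℕ) j)! = (x i + 1) * ∏ j, (x j)! := by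
    rw [← Finset.mul_prod_erase _ _ (Finset.mem_univ i),
      ← Finset.mul_prod_erase _ (fun j => (x j)!) (Finset.mem_univ i), ← mul_assoc]
    congr 1
    · simp [Nat.factorial_succ]
    · refine Finset.prod_congr rfl fun j hj => ?_
      simp [Finset.ne_of_mem_erase hj]
  have hfact : ((∏ j, (x j)! : ℕ) : ℝ) ≠ 0 := by positivity
  have hi : (x i : ℝ) + 1 ≠ 0 := by positivity
  rw [tupleWeight, hsum, hprod, tupleWeight, Pi.add_apply, Pi.single_eq_same]
  push_cast at hfact ⊢
  field_simp
  exact pow_succ' ..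

theorem filter_orderTuples_ne_zero {k : ℕ} (n : ℕ) (i : Fin k) :
    {x ∈ orderTuples k (n + (i + 1)) | x i ≠ 0} =
      (orderTuples k n).map (addRightEmbedding (Pi.single i 1)) := by
  have hsum (y : Fin k → ℕ) :
      ∑ j : Fin k, ((j : ℕ) + 1) * (y + Pi.single i 1 : Fin k → ℕ) j =
        ∑ j : Fin k, ((j : ℕ) + 1) * y j + (i + 1) := by
    simp [mul_add, Finset.sum_add_distrib, Pi.single_apply]
  ext x
  simp only [Finset.mem_filter, Finset.mem_map, mem_orderTuples, addRightEmbedding_apply]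
  constructor
  · rintro ⟨hx, hxi⟩
    have hle : Pi.single i 1 ≤ x :=
      update_le_iff.2 ⟨Nat.one_le_iff_ne_zero.2 hxi, fun _ _ => Nat.zero_le _⟩
    refine ⟨x - Pi.single i 1, ?_, tsub_add_cancel_of_le hle⟩
    rw [← tsub_add_cancel_of_le hle, hsum] at hx
    exact Nat.add_right_cancel hx
  · rintro ⟨y, hy, rfl⟩
    exact ⟨by rw [hsum, hy], by simp⟩

/-- The mass function of the Poisson distribution of order `k` without its factor `e^{-k l}`. It is
extended by zero to the negative integers, so that its recurrence needs no boundary terms. -/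
noncomputable def orderCoeff (k : ℕ) (l : ℝ) (n : ℤ) : ℝ :=
  if 0 ≤ n then ∑ x ∈ orderTuples k n.toNat, tupleWeight l x else 0

section orderCoeff

variable (k : ℕ) (l : ℝ)

theorem orderCoeff_natCast (n : ℕ) :
    orderCoeff k l n = ∑ x ∈ orderTuples k n, tupleWeight l x := by
  simp [orderCoeff]

variable {k l} in
theorem orderCoeff_of_neg {n : ℤ} (hn : n < 0) : orderCoeff k l n = 0 :=
  if_neg hn.not_ge

theorem poissonOrderPMF_eq_exp_mul_orderCoeff (n : ℕ) :
    poissonOrderPMF k l n = Real.exp (-(k * l)) * orderCoeff k l n := by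
  rw [orderCoeff_natCast, Finset.mul_sum]
  rfl

theorem orderCoeff_zero : orderCoeff k l 0 = 1 := by
  have h : orderTuples k 0 = {0} := by
    ext x
    simp [mem_orderTuples, funext_iff]
  simpa [h, tupleWeight] using orderCoeff_natCast k l 0

variable {k} in
theorem sum_coord_mul_tupleWeight (n : ℕ) (i : Fin k) :
    ∑ x ∈ orderTuples k n, (x i : ℝ) * tupleWeight l x =
      l * orderCoeff k l ((n : ℤ) - 1 - (i : ℕ)) := by
  have hfilter : ∑ x ∈ orderTuples k n, (x i : ℝ) * tupleWeight l x =
      ∑ x ∈ orderTuples k n with x i ≠ 0, (x i : ℝ) * tupleWeight l x :=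
    (Finset.sum_filter_of_ne fun x _ hx => by simpa using left_ne_zero_of_mul hx).symm
  rw [hfilter]
  rcases le_or_gt ((i : ℕ) + 1) n with hn | hn
  · obtain ⟨m, rfl⟩ := Nat.exists_eq_add_of_le' hn
    have hm : ((m + ((i : ℕ) + 1) : ℕ) : ℤ) - 1 - (i : ℕ) = (m : ℕ) := by push_cast; ring
    rw [filter_orderTuples_ne_zero, Finset.sum_map, hm, orderCoeff_natCast, Finset.mul_sum]
    exact Finset.sum_congr rfl fun x _ => succ_mul_tupleWeight_add_single l x i
  · rw [orderCoeff_of_neg (by omega), mul_zero]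
    refine Finset.sum_eq_zero fun x hx => ?_
    obtain ⟨hx, hxi⟩ := Finset.mem_filter.1 hx
    have hle : ((i : ℕ) + 1) * x i ≤ n := by
      rw [← mem_orderTuples.1 hx]
      exact Finset.single_le_sum (f := fun j : Fin k => ((j : ℕ) + 1) * x j)
        (fun _ _ => Nat.zero_le _) (Finset.mem_univ i)
    have := Nat.le_mul_of_pos_right ((i : ℕ) + 1) (Nat.pos_of_ne_zero hxi)
    omega

theorem mul_orderCoeff (n : ℤ) :
    n * orderCoeff k l n =
      l * ∑ i ∈ Finset.range k, ((i : ℝ) + 1) * orderCoeff k l (n - 1 - i) := by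
  rcases lt_or_ge n 0 with hn | hn
  · rw [orderCoeff_of_neg hn, Finset.sum_eq_zero, mul_zero, mul_zero]
    intro i _
    rw [orderCoeff_of_neg (by omega), mul_zero]
  · lift n to ℕ using hn
    calc ((n : ℤ) : ℝ) * orderCoeff k l n
        = ∑ x ∈ orderTuples k n, ∑ i : Fin k, ((i : ℕ) + 1 : ℝ) * (x i * tupleWeight l x) := by
          rw [orderCoeff_natCast, Finset.mul_sum]
          refine Finset.sum_congr rfl fun x hx => ?_
          rw [← mem_orderTuples.1 hx]
          push_cast
          simp only [Finset.sum_mul, mul_assoc]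
      _ = l * ∑ i ∈ Finset.range k, ((i : ℝ) + 1) * orderCoeff k l (n - 1 - i) := by
          rw [Finset.sum_comm, Finset.sum_range, Finset.mul_sum]
          refine Finset.sum_congr rfl fun i _ => ?_
          rw [← Finset.mul_sum, sum_coord_mul_tupleWeight, mul_left_comm]

end orderCoeff

theorem sum_range_succ_eq_choose_two (R : Type*) [CommSemiring R] (k : ℕ) :
    ∑ i ∈ Finset.range k, ((i : R) + 1) = ((k + 1).choose 2 : ℕ) := by
  induction k with
  | zero => simp
  | succ k ih =>
    rw [Finset.sum_range_succ, ih, Nat.choose_succ_succ' (k + 1), Nat.choose_one_right]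
    push_cast
    ring

theorem orderCoeff_lt_of_forall_le {k N : ℕ} {l M : ℝ} (hl : 0 ≤ l)
    (hN : l * (k + 1).choose 2 ≤ N) (hM : ∀ n : ℕ, n ≤ N → orderCoeff k l n ≤ M) (n : ℕ)
    (hn : N < n) : orderCoeff k l n < M := by
  have hMpos : 0 < M := one_pos.trans_le (by simpa [orderCoeff_zero] using hM 0 N.zero_le)
  induction n using Nat.strong_induction_on with
  | _ n ih =>
    have hle (i : ℕ) : orderCoeff k l ((n : ℤ) - 1 - i) ≤ M := by
      rcases lt_or_ge ((n : ℤ) - 1 - i) 0 with hi | hi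
      · exact (orderCoeff_of_neg hi).trans_le hMpos.le
      · obtain ⟨m, hm⟩ := Int.eq_ofNat_of_zero_le hi
        rw [hm]
        rcases le_or_gt m N with hmN | hmN
        exacts [hM m hmN, (ih m (by omega) hmN).le]
    refine lt_of_mul_lt_mul_left ?_ n.cast_nonneg
    calc (n : ℝ) * orderCoeff k l n
        = l * ∑ i ∈ Finset.range k, ((i : ℝ) + 1) * orderCoeff k l ((n : ℤ) - 1 - i) := by
          simpa using mul_orderCoeff k l n
      _ ≤ l * ∑ i ∈ Finset.range k, ((i : ℝ) + 1) * M := by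
          gcongr with i
          exact hle i
      _ = l * (k + 1).choose 2 * M := by
          rw [← Finset.sum_mul, sum_range_succ_eq_choose_two, mul_assoc]
      _ < n * M := by
          gcongr
          exact hN.trans_lt (Nat.cast_lt.2 hn)

theorem sum_succ_mul_sub {R : Type*} [CommRing R] (g : ℕ → R) (k : ℕ) :
    ∑ i ∈ Finset.range k, ((i : R) + 1) * (g 0 - g (i + 1)) =
      ∑ i ∈ Finset.range k,
        (((k + 1).choose 2 : R) - ((i + 1).choose 2 : R)) * (g i - g (i + 1)) := by
  induction k with
  | zero => simp
  | succ k ih =>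
    have hchoose : ((k + 2).choose 2 : R) = k + 1 + (k + 1).choose 2 := by
      rw [Nat.choose_succ_succ' (k + 1), Nat.choose_one_right]
      push_cast
      ring
    have htelescope : ∑ i ∈ Finset.range (k + 1), (g i - g (i + 1)) = g 0 - g (k + 1) :=
      Finset.sum_range_sub' g (k + 1)
    calc ∑ i ∈ Finset.range (k + 1), ((i : R) + 1) * (g 0 - g (i + 1))
        = ∑ i ∈ Finset.range (k + 1),
              (((k + 1).choose 2 : R) - ((i + 1).choose 2 : R)) * (g i - g (i + 1)) +
            (k + 1) * ∑ i ∈ Finset.range (k + 1), (g i - g (i + 1)) := by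
          rw [Finset.sum_range_succ, ih, htelescope, Finset.sum_range_succ _ k]
          ring
      _ = _ := by
          rw [Finset.mul_sum, ← Finset.sum_add_distrib]
          refine Finset.sum_congr rfl fun i _ => ?_
          rw [hchoose]
          ring

/-- The increment of `orderCoeff` at `n`. -/
noncomputable def orderDiff (k : ℕ) (l : ℝ) (n : ℤ) : ℝ :=
  orderCoeff k l n - orderCoeff k l (n - 1)

theorem orderDiff_of_neg {k : ℕ} {l : ℝ} {n : ℤ} (hn : n < 0) : orderDiff k l n = 0 := by
  rw [orderDiff, orderCoeff_of_neg hn, orderCoeff_of_neg (by omega), sub_zero]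

theorem orderDiff_zero (k : ℕ) (l : ℝ) : orderDiff k l 0 = 1 := by
  rw [orderDiff, orderCoeff_zero, orderCoeff_of_neg (by omega), sub_zero]

/-- The coefficient of `orderDiff k l (n - 1 - i)` in the recurrence for the increments, where
`t = l k (k + 1) / 2 + 1 - n` is the distance of `n` from one more than the mean. -/
def diffWeight {R : Type*} [CommRing R] (k : ℕ) (t : R) (i : ℕ) : R :=
  (i + 1) * t - ((k + 1).choose 2 - (i + 1).choose 2)

theorem mul_orderDiff (k : ℕ) (l : ℝ) {n : ℤ} {t : ℝ} (ht : n + t = l * (k + 1).choose 2 + 1) :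
    n * t * orderDiff k l n =
      l * ∑ i ∈ Finset.range k, diffWeight k t i * orderDiff k l (n - 1 - i) := by
  set g : ℕ → ℝ := fun i => orderCoeff k l (n - 1 - i) with hg
  have hdiff (i : ℕ) : orderDiff k l (n - 1 - i) = g i - g (i + 1) := by
    simp only [hg, orderDiff, Nat.cast_succ, sub_sub, add_assoc]
  have hn : n * orderCoeff k l n = l * ∑ i ∈ Finset.range k, ((i : ℝ) + 1) * g i :=
    mul_orderCoeff k l n
  have hpred : (n - 1) * g 0 = l * ∑ i ∈ Finset.range k, ((i : ℝ) + 1) * g (i + 1) := by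
    have h := mul_orderCoeff k l (n - 1)
    simp only [sub_right_comm (n - 1), Int.cast_sub, Int.cast_one] at h
    simpa only [hg, Nat.cast_succ, sub_sub, add_assoc, Nat.cast_zero, add_zero] using h
  have hsum : ∑ i ∈ Finset.range k, diffWeight k t i * (g i - g (i + 1)) =
      t * ∑ i ∈ Finset.range k, ((i : ℝ) + 1) * g i -
        (t - 1) * ∑ i ∈ Finset.range k, ((i : ℝ) + 1) * g (i + 1) - (k + 1).choose 2 * g 0 := by
    have habel := sum_succ_mul_sub g k
    simp only [mul_sub _ (g 0), Finset.sum_sub_distrib, ← Finset.sum_mul,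
      sum_range_succ_eq_choose_two] at habel
    calc ∑ i ∈ Finset.range k, diffWeight k t i * (g i - g (i + 1))
        = ∑ i ∈ Finset.range k, (t * ((i + 1) * g i) - t * ((i + 1) * g (i + 1)) -
            ((k + 1).choose 2 - (i + 1).choose 2) * (g i - g (i + 1))) :=
          Finset.sum_congr rfl fun i _ => by rw [diffWeight]; ring
      _ = _ := by
          rw [Finset.sum_sub_distrib, Finset.sum_sub_distrib, ← habel, ← Finset.mul_sum,
            ← Finset.mul_sum]
          ring
  have hzero : orderDiff k l n = orderCoeff k l n - g 0 := by simp [hg, orderDiff]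
  simp only [hdiff, hsum, hzero]
  linear_combination t * hn - (t - 1) * hpred - g 0 * ht

theorem diffWeight_nonneg {R : Type*} [CommRing R] [LinearOrder R] [IsStrictOrderedRing R] {k : ℕ}
    {t : R} (ht : ((k + 1).choose 2 : R) ≤ t) (i : ℕ) : 0 ≤ diffWeight k t i := by
  have ht0 : 0 ≤ t := le_trans (Nat.cast_nonneg _) ht
  calc (0 : R) ≤ i * t + (i + 1).choose 2 + (t - (k + 1).choose 2) :=
        add_nonneg (by positivity) (sub_nonneg.2 ht)
    _ = diffWeight k t i := by rw [diffWeight]; ring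

theorem diffWeight_one_pos {R : Type*} [CommRing R] [LinearOrder R] [IsStrictOrderedRing R] {k : ℕ}
    {t : R} (ht : ((k + 1).choose 2 : R) ≤ t) : 0 < diffWeight k t 1 := by
  have ht0 : 0 ≤ t := le_trans (Nat.cast_nonneg _) ht
  calc (0 : R) < t + 1 + (t - (k + 1).choose 2) :=
        add_pos_of_pos_of_nonneg (by positivity) (sub_nonneg.2 ht)
    _ = diffWeight k t 1 := by simp [diffWeight]; ring

theorem orderDiff_one {k : ℕ} (hk : 1 ≤ k) (l : ℝ) : orderDiff k l 1 = l - 1 := by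
  have hsum : ∑ i ∈ Finset.range k, ((i : ℝ) + 1) * orderCoeff k l (1 - 1 - i) = 1 := by
    rw [Finset.sum_eq_single_of_mem 0 (Finset.mem_range.2 hk)]
    · simp [orderCoeff_zero]
    · intro i _ hi
      rw [orderCoeff_of_neg (by omega), mul_zero]
  have hone := mul_orderCoeff k l 1
  rw [hsum, Int.cast_one, one_mul, mul_one] at hone
  rw [orderDiff, hone, sub_self, orderCoeff_zero]

/-- In this range all the weights `diffWeight k t i` are nonnegative. -/
theorem orderDiff_pos_of_add_le {k : ℕ} (hk : 2 ≤ k) {l : ℝ} (hl : 1 < l) (n : ℕ)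
    (hn : (n + (k + 1).choose 2 : ℝ) ≤ l * (k + 1).choose 2 + 1) : 0 < orderDiff k l n := by
  induction n using Nat.strong_induction_on with
  | _ n ih =>
    have hpos (m : ℕ) (hm : m < n) : 0 < orderDiff k l m :=
      ih m hm <| le_trans (by gcongr) hn
    match n with
    | 0 => simp [orderDiff_zero]
    | 1 => simpa [orderDiff_one (one_le_two.trans hk)] using hl
    | n + 2 =>
      set t : ℝ := l * (k + 1).choose 2 + 1 - (n + 2 : ℕ) with ht
      have hKt : ((k + 1).choose 2 : ℝ) ≤ t := by linarith
      have htpos : 0 < t := lt_of_lt_of_le (Nat.cast_pos.2 (Nat.choose_pos (by omega))) hKt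
      have hsum : 0 < ∑ i ∈ Finset.range k,
          diffWeight k t i * orderDiff k l (((n + 2 : ℕ) : ℤ) - 1 - i) := by
        refine Finset.sum_pos' (fun i _ => mul_nonneg (diffWeight_nonneg hKt i) ?_)
          ⟨1, Finset.mem_range.2 hk, mul_pos (diffWeight_one_pos hKt) ?_⟩
        · rcases lt_or_ge (((n + 2 : ℕ) : ℤ) - 1 - i) 0 with hi | hi
          · exact (orderDiff_of_neg hi).ge
          · obtain ⟨m, hm⟩ := Int.eq_ofNat_of_zero_le hi
            rw [hm]
            exact (hpos m (by omega)).le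
        · have hcast : ((n + 2 : ℕ) : ℤ) - 1 - (1 : ℕ) = n := by push_cast; ring
          rw [hcast]
          exact hpos n (by omega)
      have hprod := mul_pos (zero_lt_one.trans hl) hsum
      rw [← mul_orderDiff k l (by rw [ht]; push_cast; ring)] at hprod
      exact (pos_iff_pos_of_mul_pos hprod).1 (mul_pos (by positivity) htpos)

section evalCoeffs

variable {R : Type*} [CommRing R]

/-- The value at `u` of the polynomial with the listed coefficients, constant term first. Lists are
used instead of `Polynomial ℤ` because the kernel can compute with them. -/
def evalCoeffs (u : R) : List ℤ → R
  | [] => 0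
  | a :: p => a + u * evalCoeffs u p

/-- The coefficients of the sum of two polynomials. -/
def addCoeffs : List ℤ → List ℤ → List ℤ
  | [], q => q
  | p, [] => p
  | a :: p, b :: q => (a + b) :: addCoeffs p q

/-- The coefficients of `c + (a + b X) p`, where `p` is a polynomial; `c` is the carry in the
recursion. -/
def linearMulAddCoeffs (a b : ℤ) (c : ℤ) : List ℤ → List ℤ
  | [] => [c]
  | x :: p => (c + a * x) :: linearMulAddCoeffs a b (b * x) p

theorem evalCoeffs_addCoeffs (u : R) (p q : List ℤ) :
    evalCoeffs u (addCoeffs p q) = evalCoeffs u p + evalCoeffs u q := by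
  fun_induction addCoeffs p q with
  | case1 => simp [evalCoeffs]
  | case2 => simp [evalCoeffs]
  | case3 a p b q ih =>
    simp only [evalCoeffs, ih]
    push_cast
    ring

theorem evalCoeffs_linearMulAddCoeffs (u : R) (a b c : ℤ) (p : List ℤ) :
    evalCoeffs u (linearMulAddCoeffs a b c p) = c + (a + b * u) * evalCoeffs u p := by
  induction p generalizing c with
  | nil => simp [linearMulAddCoeffs, evalCoeffs]
  | cons x p ih =>
    simp only [linearMulAddCoeffs, evalCoeffs, ih]
    push_cast
    ring

variable [PartialOrder R] [IsOrderedRing R]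

theorem evalCoeffs_nonneg {u : R} (hu : 0 ≤ u) {p : List ℤ} (hp : ∀ a ∈ p, 0 ≤ a) :
    0 ≤ evalCoeffs u p := by
  induction p with
  | nil => exact le_rfl
  | cons a p ih =>
    rw [List.forall_mem_cons] at hp
    exact add_nonneg (Int.cast_nonneg hp.1) (mul_nonneg hu (ih hp.2))

theorem evalCoeffs_pos [Nontrivial R] {u : R} (hu : 0 ≤ u) {p : List ℤ} (hp : ∀ a ∈ p, 0 ≤ a)
    (hp0 : 0 < p.headD 0) : 0 < evalCoeffs u p := by
  cases p with
  | nil => exact absurd hp0 (lt_irrefl 0)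
  | cons a p =>
    rw [List.forall_mem_cons] at hp
    exact add_pos_of_pos_of_nonneg (Int.cast_pos.2 hp0) (mul_nonneg hu (evalCoeffs_nonneg hu hp.2))

end evalCoeffs

/-- The value at `x 0, …, x (k - 1)` of the linear form whose `i`-th coefficient is the polynomial
`c.getD i []`, evaluated at `u`. -/
def evalForm (k : ℕ) (u : ℝ) (c : List (List ℤ)) (x : ℕ → ℝ) : ℝ :=
  ∑ i ∈ Finset.range k, evalCoeffs u (c.getD i []) * x i

theorem evalForm_singleton {k : ℕ} (hk : 1 ≤ k) (u : ℝ) (a : ℤ) (x : ℕ → ℝ) :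
    evalForm k u [[a]] x = a * x 0 := by
  rw [evalForm, Finset.sum_eq_single_of_mem 0 (Finset.mem_range.2 hk)]
  · simp [evalCoeffs]
  · intro i _ hi
    obtain ⟨i, rfl⟩ := Nat.exists_eq_succ_of_ne_zero hi
    simp [evalCoeffs]

/-- A sufficient condition, on the integers in `c`, for the linear form `evalForm k u c` to be
positive at positive arguments for all `u ≥ 0`. -/
def IsPositiveForm (c : List (List ℤ)) : Prop :=
  (∀ p ∈ c, ∀ a ∈ p, 0 ≤ a) ∧ 0 < (c.getD 0 []).headD 0

instance : DecidablePred IsPositiveForm := fun c =>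
  inferInstanceAs (Decidable ((∀ p ∈ c, ∀ a ∈ p, 0 ≤ a) ∧ 0 < (c.getD 0 []).headD 0))

theorem IsPositiveForm.evalForm_pos {c : List (List ℤ)} (hc : IsPositiveForm c) {k : ℕ}
    (hk : 1 ≤ k) {u : ℝ} (hu : 0 ≤ u) {x : ℕ → ℝ} (hx : ∀ i < k, 0 < x i) :
    0 < evalForm k u c x := by
  have hnonneg (i : ℕ) : ∀ a ∈ c.getD i [], 0 ≤ a := by
    rcases lt_or_ge i c.length with hi | hi
    · rw [List.getD_eq_getElem _ _ hi]
      exact hc.1 _ (List.getElem_mem hi)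
    · rw [List.getD_eq_default _ _ hi]
      exact List.forall_mem_nil _
  refine Finset.sum_pos' (fun i hi => ?_) ⟨0, Finset.mem_range.2 hk, ?_⟩
  · exact mul_nonneg (evalCoeffs_nonneg hu (hnonneg i)) (hx i (Finset.mem_range.1 hi)).le
  · exact mul_pos (evalCoeffs_pos hu (hnonneg 0) hc.2) (hx 0 hk)

/-- One step of the recurrence `mul_orderDiff`, for the parameter `l = u + 3`: from a linear form in
the increments at the distances `t, …, t + k - 1` below one more than the mean it eliminates the
increment at the distance `t`. The result, multiplied by the factor `n t` to clear the denominator,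
is a form in the increments at the distances `t + 1, …, t + k`. -/
def eliminate (k t : ℕ) (c : List (List ℤ)) : List (List ℤ) :=
  (List.range k).map fun i => addCoeffs
    (linearMulAddCoeffs (3 * diffWeight k (t : ℤ) i) (diffWeight k (t : ℤ) i) 0 (c.getD 0 []))
    (linearMulAddCoeffs ((3 * (k + 1).choose 2 + 1 - t) * t) ((k + 1).choose 2 * t) 0
      (c.getD (i + 1) []))

theorem length_eliminate (k t : ℕ) (c : List (List ℤ)) : (eliminate k t c).length = k := by
  simp [eliminate]

theorem evalForm_eliminate {k t : ℕ} {u : ℝ} {n : ℤ} (hn : n + t = (u + 3) * (k + 1).choose 2 + 1)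
    {c : List (List ℤ)} (hc : c.length ≤ k) :
    evalForm k u (eliminate k t c) (fun i => orderDiff k (u + 3) (n - 1 - i)) =
      n * t * evalForm k u c (fun i => orderDiff k (u + 3) (n - i)) := by
  have hlast : evalCoeffs u (c.getD k []) = 0 := by
    rw [List.getD_eq_default _ _ hc, evalCoeffs]
  have hcoeff (i : ℕ) (hi : i < k) : evalCoeffs u ((eliminate k t c).getD i []) =
      (u + 3) * diffWeight k (t : ℝ) i * evalCoeffs u (c.getD 0 []) +
        n * t * evalCoeffs u (c.getD (i + 1) []) := by
    have hweight : ((diffWeight k (t : ℤ) i : ℤ) : ℝ) = diffWeight k (t : ℝ) i := by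
      simp [diffWeight]
    rw [eq_sub_of_add_eq hn, eliminate, List.getD_eq_getElem _ _ (by simpa using hi),
      List.getElem_map, List.getElem_range, evalCoeffs_addCoeffs,
      evalCoeffs_linearMulAddCoeffs, evalCoeffs_linearMulAddCoeffs]
    push_cast
    rw [hweight]
    ring
  have hshift (i : ℕ) : n - 1 - (i : ℤ) = n - (i + 1 : ℕ) := by push_cast; ring
  calc evalForm k u (eliminate k t c) (fun i => orderDiff k (u + 3) (n - 1 - i))
      = evalCoeffs u (c.getD 0 []) * ((u + 3) *
            ∑ i ∈ Finset.range k, diffWeight k (t : ℝ) i * orderDiff k (u + 3) (n - 1 - i)) +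
          n * t * ∑ i ∈ Finset.range k,
            evalCoeffs u (c.getD (i + 1) []) * orderDiff k (u + 3) (n - 1 - i) := by
        simp only [evalForm, Finset.mul_sum, ← Finset.sum_add_distrib]
        refine Finset.sum_congr rfl fun i hi => ?_
        rw [hcoeff i (Finset.mem_range.1 hi)]
        ring
    _ = n * t * ∑ i ∈ Finset.range (k + 1),
          evalCoeffs u (c.getD i []) * orderDiff k (u + 3) (n - i) := by
        rw [← mul_orderDiff k (u + 3) hn, Finset.sum_range_succ']
        simp only [hshift, Nat.cast_zero, sub_zero]
        ring
    _ = n * t * evalForm k u c (fun i => orderDiff k (u + 3) (n - i)) := by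
        rw [Finset.sum_range_succ, hlast, zero_mul, add_zero, evalForm]

/-- Performs `r` eliminations, at the distances `t, …, t + r - 1`. -/
def eliminateIter (k : ℕ) : ℕ → ℕ → List (List ℤ) → List (List ℤ)
  | 0, _, c => c
  | r + 1, t, c => eliminateIter k r (t + 1) (eliminate k t c)

theorem exists_evalForm_eliminateIter {k t r : ℕ} {u : ℝ} {n : ℤ}
    (hn : n + t = (u + 3) * (k + 1).choose 2 + 1) (ht : 0 < t) (hr : r ≤ n) {c : List (List ℤ)}
    (hc : c.length ≤ k) :
    ∃ P : ℝ, 0 < P ∧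
      evalForm k u (eliminateIter k r t c) (fun i => orderDiff k (u + 3) (n - r - i)) =
        P * evalForm k u c (fun i => orderDiff k (u + 3) (n - i)) := by
  induction r generalizing t n c with
  | zero => exact ⟨1, one_pos, by simp [eliminateIter]⟩
  | succ r ih =>
    have hn' : ((n - 1 : ℤ) : ℝ) + (t + 1 : ℕ) = (u + 3) * (k + 1).choose 2 + 1 := by
      push_cast
      linarith
    obtain ⟨P, hP, h⟩ := ih hn' t.succ_pos (by omega) (length_eliminate k t c).le
    have hnpos : (0 : ℝ) < n := Int.cast_pos.2 (by omega)
    refine ⟨P * (n * t), by positivity, ?_⟩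
    rw [eliminateIter, mul_assoc, ← evalForm_eliminate hn hc, ← h, Nat.cast_succ,
      sub_add_eq_sub_sub, sub_right_comm n]

/-- The distance at which the elimination stops. The values were found by experiment, subject to
`windowDist_bounds`, which places the remaining increments where `orderDiff_pos_of_add_le` applies
whenever `3 ≤ l`. -/
def windowDist : ℕ → ℕ
  | 2 => 7
  | 3 => 15
  | 4 => 19
  | _ => 21

theorem windowDist_bounds : ∀ k ∈ Finset.Icc 2 5,
    (k + 1).choose 2 ≤ windowDist k ∧ windowDist k + k ≤ 3 * (k + 1).choose 2 + 2 := by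
  decide

theorem isPositiveForm_eliminateIter :
    ∀ k ∈ Finset.Icc 2 5, ∀ t ∈ Finset.Ico 1 ((k + 1).choose 2), IsPositiveForm <|
      eliminateIter k (windowDist k - t) t [[if k / 2 < t then 1 else -1]] := by
  decide +kernel

theorem sign_mul_orderDiff_pos {k : ℕ} (hk : k ∈ Finset.Icc 2 5) {l : ℝ} (hl : 3 ≤ l) {n : ℤ}
    {t : ℕ} (ht : t ∈ Finset.Ico 1 ((k + 1).choose 2)) (hn : n + t = l * (k + 1).choose 2 + 1) :
    0 < ((if k / 2 < t then 1 else -1 : ℤ) : ℝ) * orderDiff k l n := by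
  obtain ⟨u, rfl⟩ : ∃ u, l = u + 3 := ⟨l - 3, by ring⟩
  obtain ⟨ht1, htK⟩ := Finset.mem_Ico.1 ht
  obtain ⟨hk2, -⟩ := Finset.mem_Icc.1 hk
  set r := windowDist k - t
  obtain ⟨hKT, hTK⟩ := windowDist_bounds k hk
  have hmean : 3 * (k + 1).choose 2 + 1 ≤ n + t := by
    have h : (3 : ℝ) * (k + 1).choose 2 + 1 ≤ n + t := by rw [hn]; gcongr
    exact_mod_cast h
  have hpos (i : ℕ) (hi : i < k) : 0 < orderDiff k (u + 3) (n - r - i) := by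
    obtain ⟨s, hs⟩ := Int.eq_ofNat_of_zero_le (a := n - r - i) (by omega)
    have hsK : ((s : ℤ) : ℝ) + (k + 1).choose 2 ≤ n + t := by
      norm_cast
      omega
    rw [hs]
    exact orderDiff_pos_of_add_le hk2 (by linarith) s (hsK.trans_eq hn)
  obtain ⟨P, hP, hform⟩ := exists_evalForm_eliminateIter (r := r) hn ht1 (by omega)
    (c := [[if k / 2 < t then 1 else -1]]) (one_le_two.trans hk2)
  have hformpos := (isPositiveForm_eliminateIter k hk t ht).evalForm_pos (one_le_two.trans hk2)
    (sub_nonneg.2 hl) hpos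
  rw [add_sub_cancel_right, hform, evalForm_singleton (one_le_two.trans hk2)] at hformpos
  simpa using pos_of_mul_pos_right hformpos hP.le

theorem orderDiff_pos {k : ℕ} (hk : k ∈ Finset.Icc 2 5) {l : ℝ} (hl : 3 ≤ l) {n t : ℕ}
    (ht : k / 2 < t) (hn : (n + t : ℝ) = l * (k + 1).choose 2 + 1) : 0 < orderDiff k l n := by
  rcases lt_or_ge t ((k + 1).choose 2) with htK | htK
  · simpa [ht] using sign_mul_orderDiff_pos (n := n) hk hl
      (Finset.mem_Ico.2 ⟨Nat.zero_lt_of_lt ht, htK⟩) (mod_cast hn)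
  · refine orderDiff_pos_of_add_le (Finset.mem_Icc.1 hk).1 (by linarith) n ?_
    rw [← hn]
    gcongr

theorem orderDiff_neg {k : ℕ} (hk : k ∈ Finset.Icc 2 5) {l : ℝ} (hl : 3 ≤ l) {n t : ℕ}
    (ht : t ∈ Set.Icc 1 (k / 2)) (hn : (n + t : ℝ) = l * (k + 1).choose 2 + 1) :
    orderDiff k l n < 0 := by
  have hkK : k / 2 < (k + 1).choose 2 :=
    (by decide : ∀ k ∈ Finset.Icc 2 5, k / 2 < (k + 1).choose 2) k hk
  simpa [ht.2.not_gt] using sign_mul_orderDiff_pos (n := n) hk hl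
    (Finset.mem_Ico.2 ⟨ht.1, ht.2.trans_lt hkK⟩) (mod_cast hn)

/-- The mode, in natural numbers; the subtraction does not truncate for `1 ≤ l`, by
`half_le_mean`. -/
def orderMode (k l : ℕ) : ℕ :=
  l * (k + 1).choose 2 - k / 2

theorem orderCoeff_lt_orderMode_of_three_le {k l n : ℕ} (hk : k ∈ Finset.Icc 2 5) (hl : 3 ≤ l)
    (hn : n ≤ l * (k + 1).choose 2) (hne : n ≠ orderMode k l) :
    orderCoeff k l n < orderCoeff k l (orderMode k l) := by
  have hl' : (3 : ℝ) ≤ l := Nat.ofNat_le_cast.2 hl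
  rw [orderMode] at hne ⊢
  set N := l * (k + 1).choose 2 with hN
  have hdist (a : ℕ) (ha : a + 1 ≤ N) :
      (((a + 1 : ℕ) : ℝ) + (N - a : ℕ) : ℝ) = l * (k + 1).choose 2 + 1 := by
    rw [← Nat.cast_mul, ← hN]
    norm_cast
    omega
  have hmono : StrictMonoOn (fun n : ℕ => orderCoeff k l n) (Set.Iic (N - k / 2)) := by
    refine strictMonoOn_of_lt_succ Set.ordConnected_Iic fun a _ _ ha => ?_
    rw [Nat.succ_eq_succ, Set.mem_Iic, Nat.succ_eq_add_one] at ha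
    simpa [orderDiff] using orderDiff_pos hk hl' (t := N - a) (by omega) (hdist a (by omega))
  have hanti : StrictAntiOn (fun n : ℕ => orderCoeff k l n) (Set.Icc (N - k / 2) N) := by
    refine strictAntiOn_of_succ_lt Set.ordConnected_Icc fun a _ ⟨ha, _⟩ ⟨_, haN⟩ => ?_
    rw [Nat.succ_eq_succ, Nat.succ_eq_add_one] at haN
    simpa [orderDiff] using
      orderDiff_neg hk hl' (t := N - a) ⟨by omega, by omega⟩ (hdist a (by omega))
  rcases hne.lt_or_gt with hlt | hgt
  · exact hmono hlt.le Set.self_mem_Iic hlt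
  · exact hanti (Set.left_mem_Icc.2 tsub_le_self) ⟨hgt.le, hn⟩ hgt

/-- The values `orderCoeff k l n, …, orderCoeff k l 0`, as rational numbers so that the kernel can
compute with them. -/
def coeffList (k l : ℕ) : ℕ → List ℚ
  | 0 => [1]
  | n + 1 => (l / (n + 1) * ∑ i ∈ Finset.range k, ((i : ℚ) + 1) * (coeffList k l n).getD i 0) ::
      coeffList k l n

theorem coeffList_getD (k l n i : ℕ) :
    (((coeffList k l n).getD i 0 : ℚ) : ℝ) = orderCoeff k l ((n : ℤ) - i) := by
  induction n generalizing i with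
  | zero =>
    cases i with
    | zero => simp [coeffList, orderCoeff_zero]
    | succ i =>
      rw [orderCoeff_of_neg (by omega)]
      simp [coeffList]
  | succ n ih =>
    cases i with
    | zero =>
      have hrec := mul_orderCoeff k l ((n + 1 : ℕ) : ℤ)
      have hn : (n : ℝ) + 1 ≠ 0 := by positivity
      rw [coeffList, List.getD_cons_zero, Nat.cast_zero, sub_zero]
      push_cast at hrec ⊢
      simp only [ih]
      rw [add_sub_cancel_right] at hrec
      rw [div_mul_eq_mul_div, ← hrec, mul_div_cancel_left₀ _ hn]
    | succ i =>
      rw [coeffList, List.getD_cons_succ, ih, Nat.cast_succ, Nat.cast_succ,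
        add_sub_add_right_eq_sub]

theorem coeffList_getD_lt_getD_half : ∀ k ∈ Finset.Icc 2 5, ∀ l ∈ Finset.Icc 1 2,
    ∀ s ≤ l * (k + 1).choose 2, s ≠ k / 2 →
      (coeffList k l (l * (k + 1).choose 2)).getD s 0 <
        (coeffList k l (l * (k + 1).choose 2)).getD (k / 2) 0 := by
  decide +kernel

theorem half_le_mean {k l : ℕ} (hl : 1 ≤ l) : k / 2 ≤ l * (k + 1).choose 2 := by
  have hk : k ≤ (k + 1).choose 2 := by
    rw [Nat.choose_succ_succ' k, Nat.choose_one_right]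
    exact Nat.le_add_right _ _
  exact (Nat.div_le_self k 2).trans (hk.trans (Nat.le_mul_of_pos_left _ hl))

theorem orderCoeff_lt_orderMode_of_le_two {k l n : ℕ} (hk : k ∈ Finset.Icc 2 5)
    (hl : l ∈ Finset.Icc 1 2) (hn : n ≤ l * (k + 1).choose 2) (hne : n ≠ orderMode k l) :
    orderCoeff k l n < orderCoeff k l (orderMode k l) := by
  have hhalf : k / 2 ≤ l * (k + 1).choose 2 := half_le_mean (Finset.mem_Icc.1 hl).1
  rw [orderMode] at hne ⊢
  have h := coeffList_getD_lt_getD_half k hk l hl (l * (k + 1).choose 2 - n) tsub_le_self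
    (by omega)
  rw [← Rat.cast_lt (K := ℝ), coeffList_getD, coeffList_getD, ← Nat.cast_sub tsub_le_self,
    tsub_tsub_cancel_of_le hn, ← Nat.cast_sub hhalf] at h
  exact h

theorem orderCoeff_lt_orderMode {k l n : ℕ} (hk : k ∈ Finset.Icc 2 5) (hl : 1 ≤ l)
    (hne : n ≠ orderMode k l) :
    orderCoeff k l n < orderCoeff k l (orderMode k l) := by
  have hle_mean (n : ℕ) (hn : n ≤ l * (k + 1).choose 2) (hne : n ≠ orderMode k l) :
      orderCoeff k l n < orderCoeff k l (orderMode k l) := by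
    rcases lt_or_ge l 3 with hl3 | hl3
    · have hl12 : l ∈ Finset.Icc 1 2 := Finset.mem_Icc.2 ⟨hl, Nat.le_of_lt_succ hl3⟩
      exact orderCoeff_lt_orderMode_of_le_two hk hl12 hn hne
    · exact orderCoeff_lt_orderMode_of_three_le hk hl3 hn hne
  rcases le_or_gt n (l * (k + 1).choose 2) with hn | hn
  · exact hle_mean n hn hne
  · refine orderCoeff_lt_of_forall_le l.cast_nonneg (Nat.cast_mul l _).ge (fun s hs => ?_) n hn
    rcases eq_or_ne s (orderMode k l) with rfl | hs'
    exacts [le_rfl, (hle_mean s hs hs').le]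

theorem isMode_poissonOrderPMF_iff {k l m : ℕ} (hk : k ∈ Finset.Icc 2 5) (hl : 1 ≤ l) :
    IsMode (poissonOrderPMF k l) m ↔ m = orderMode k l := by
  simp only [IsMode, poissonOrderPMF_eq_exp_mul_orderCoeff,
    mul_le_mul_iff_right₀ (Real.exp_pos _)]
  constructor
  · intro hm
    by_contra hne
    exact (orderCoeff_lt_orderMode hk hl hne).not_ge (hm _)
  · rintro rfl n
    rcases eq_or_ne n (orderMode k l) with rfl | hne
    exacts [le_rfl, (orderCoeff_lt_orderMode hk hl hne).le]

theorem theorem2p2 (k l : ℕ) (hk : 2 ≤ k) (hk5 : k ≤ 5) (hl : 1 ≤ l) :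
    (∃! m : ℕ, IsMode (poissonOrderPMF k (l : ℝ)) m) ∧
      ∀ m : ℕ, IsMode (poissonOrderPMF k (l : ℝ)) m →
        (m : ℝ) = (l : ℝ) * k * (k + 1) / 2 - (⌊(k : ℝ) / 2⌋ : ℝ) := by
  simp only [isMode_poissonOrderPMF_iff (Finset.mem_Icc.2 ⟨hk, hk5⟩) hl]
  refine ⟨⟨_, rfl, fun _ h => h⟩, ?_⟩
  rintro _ rfl
  have hfloor : ⌊(k : ℝ) / 2⌋ = (k / 2 : ℕ) := by
    simpa using Int.floor_div_natCast (k : ℝ) 2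
  rw [orderMode, Nat.cast_sub (half_le_mean hl), hfloor, Int.cast_natCast, Nat.cast_mul,
    Nat.cast_choose_two]
  push_cast
  ring
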